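/- Let $\Bbbk$ be an algebraically closed field of characteristic zero, let $r,n\ge 0$, and let $A$ be an $r\times n$ integer matrix with columns $m_1,\dots,m_n\in\mathbb Z^r$. Let the torus $T=(\Bbbk^{*})^r$ act linearly on $V=\Bbbk^n$ by $t\cdot u=(t^{-m_1}u_1,\dots,t^{-m_n}u_n)$, where $t^{m}=\prod_j t_j^{m^{(j)}}$ for $m=(m^{(1)},\dots,m^{(r)})$, and let $\Bbbk[V]^T\subseteq \Bbbk[V]=\Bbbk[x_1,\dots,x_n]$ be the ring of $T$-invariant polynomials. For $\alpha\in\mathbb N^n$ (where $0\in\mathbb N$) write $x^\alpha=x_1^{\alpha_1}\cdots x_n^{\alpha_n}$ and $\operatorname{supp}(\alpha)=\{i : \alpha_i\neq 0\}$. Put $\mathcal L=\{\alpha\in\mathbb N^n : A\alpha=0\}$. Let $\mathcal S\subseteq\mathcal L$ be a subsemigroup containing $0$. For $I\subseteq\{1,\dots,n\}$ put $\mathcal L_I=\{\alpha\in\mathcal L : \operatorname{supp}(\alpha)\subseteq I\}$ and $\mathcal S_I=\mathcal L_I\cap\mathcal S$, and let $\mathbb Z\mathcal S_I$ be the subgroup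 of $\mathbb Z^n$ generated by $\mathcal S_I$. We say that $\mathcal S$ gives a separating algebra if the subalgebra $\Bbbk[x^\alpha : \alpha\in\mathcal S]$ of $\Bbbk[x_1,\dots,x_n]$ is contained in $\Bbbk[V]^T$ and, for all $u,v\in V$ such that $f(u)\neq f(v)$ for some $f\in\Bbbk[V]^T$, there is $g\in\Bbbk[x^\alpha : \alpha\in\mathcal S]$ with $g(u)\neq g(v)$. Then the following are equivalent: 1. $\mathcal S$ gives a separating algebra. 2. For every $I\subseteq\{1,\dots,n\}$ one has $\mathcal L_I\subseteq\mathbb Z\mathcal S_I$; and for every $\alpha\in\mathcal L$ and every $i\in\operatorname{supp}(\alpha)$ there is $\gamma\in\mathcal S$ with $i\in\operatorname{supp}(\gamma)\subseteq\operatorname{supp}(\alpha)$. 3. For every prime number $p$ there is $m\ge 1$ such that $p^m\mathcal L\subseteq\mathcal S$. 4. There are distinct prime numbers $p\neq q$ and an $m\ge 1$ such that $p^m\mathcal L\subseteq\mathcal S$ and $q^m\mathcal L\subseteq\mathcal S$. -/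

import Mathlib

noncomputable section

namespace TorusInvariants

variable {r n : ℕ}

/-- The linear representation of the rank-`r` torus `T = (kˣ)^r` on `V = k^n` with weights the
columns `m_1, …, m_n` of `A`: the element `t` acts by `diag(t^(-m_1), …, t^(-m_n))`, where
`t^m = ∏ j, (t j)^(m j)`. -/
def torusRep (k : Type*) [Field k] (A : Matrix (Fin r) (Fin n) ℤ) :
    Representation k (Fin r → kˣ) (Fin n → k) where
  toFun t := LinearMap.pi fun i =>
    ((∏ j, t j ^ (-A j i) : kˣ) : k) • (LinearMap.proj i : (Fin n → k) →ₗ[k] k)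
  map_one' := by
    ext u i
    simp
  map_mul' t s := by
    refine LinearMap.ext fun u => funext fun i => ?_
    simp [mul_zpow, Finset.prod_mul_distrib, mul_assoc, mul_left_comm]

/-- The ring of invariants `k[V]^G` of a representation on `V = k^n`: the polynomials `f` with
`f(g · u) = f(u)` for all `g` in `G` and `u` in `V`. -/
def invariantRing {k : Type*} [Field k] {G : Type*} [Group G]
    (ρ : Representation k G (Fin n → k)) : Subalgebra k (MvPolynomial (Fin n) k) where
  carrier := {f | ∀ (g : G) (u : Fin n → k),
    MvPolynomial.eval (ρ g u) f = MvPolynomial.eval u f}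
  mul_mem' hf hg t u := by rw [map_mul, map_mul, hf t u, hg t u]
  add_mem' hf hg t u := by rw [map_add, map_add, hf t u, hg t u]
  algebraMap_mem' c t u := by simp [MvPolynomial.algebraMap_eq]

/-- A separating algebra: a subalgebra `B` of the ring of invariants such that any two points of
`V` that are separated by some invariant are separated by an element of `B`. -/
def IsSeparatingAlgebra {k : Type*} [Field k] {G : Type*} [Group G]
    (ρ : Representation k G (Fin n → k)) (B : Subalgebra k (MvPolynomial (Fin n) k)) : Prop :=
  B ≤ invariantRing ρ ∧
    ∀ u v : Fin n → k,
      (∃ f ∈ invariantRing ρ, MvPolynomial.eval u f ≠ MvPolynomial.eval v f) →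
        ∃ f ∈ B, MvPolynomial.eval u f ≠ MvPolynomial.eval v f

/-- The monomial algebra given by a submonoid `S` of `ℕ^n`: the subalgebra of `k[x_1, …, x_n]`
generated by the monomials `x^α` for `α ∈ S`. -/
def monomialAlgebra (k : Type*) [Field k] (S : AddSubmonoid (Fin n →₀ ℕ)) :
    Subalgebra k (MvPolynomial (Fin n) k) :=
  Algebra.adjoin k ((fun α => MvPolynomial.monomial α (1 : k)) '' (S : Set (Fin n →₀ ℕ)))

/-- An exponent vector in `ℕ^n`, regarded as an element of `ℤ^n`. -/
def toIntVec (α : Fin n →₀ ℕ) : Fin n → ℤ := fun i => (α i : ℤ)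

/-- The semigroup `L = ker_ℤ A ∩ ℕ^n`. -/
def invariantSemigroup (A : Matrix (Fin r) (Fin n) ℤ) : AddSubmonoid (Fin n →₀ ℕ) where
  carrier := {α | A.mulVec (toIntVec α) = 0}
  zero_mem' := by
    have h : toIntVec (0 : Fin n →₀ ℕ) = 0 := by
      funext i
      simp [toIntVec]
    simp [h]
  add_mem' {α β} hα hβ := by
    have h : toIntVec (α + β) = toIntVec α + toIntVec β := by
      funext i
      simp [toIntVec]
    change A.mulVec (toIntVec (α + β)) = 0
    change A.mulVec (toIntVec α) = 0 at hα
    change A.mulVec (toIntVec β) = 0 at hβ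
    rw [h, Matrix.mulVec_add, hα, hβ, add_zero]

/-- `M_I`: the elements of `M ⊆ ℕ^n` whose support is contained in `I`. -/
def supportedIn (M : AddSubmonoid (Fin n →₀ ℕ)) (I : Finset (Fin n)) :
    AddSubmonoid (Fin n →₀ ℕ) where
  carrier := {α | α ∈ M ∧ ∀ j, j ∉ I → α j = 0}
  zero_mem' := ⟨M.zero_mem, fun _ _ => rfl⟩
  add_mem' hα hβ := ⟨M.add_mem hα.1 hβ.1, fun j hj => by simp [hα.2 j hj, hβ.2 j hj]⟩

/-- `ℤM`: the subgroup of `ℤ^n` generated by `M ⊆ ℕ^n`. -/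
def integerSpan (M : AddSubmonoid (Fin n →₀ ℕ)) : AddSubgroup (Fin n → ℤ) :=
  AddSubgroup.closure (toIntVec '' (M : Set (Fin n →₀ ℕ)))

end TorusInvariants

end

/-! Invariants are spanned by invariant monomials, so separation is a question about the values of
`x^α`, `α ∈ L`. If S misses something in condition 2, two explicit points expose it: either supports
are tested with 0/1 vectors, or a character of `ℤ^n / ℤS_I` nontrivial at `α` gives a torus point to
compare with the all-ones point, both set to zero off `I`. Conversely, condition 2 puts two
consecutive multiples of each `α ∈ L` in S, hence all large multiples (`exists_forall_ge_smul_mem`).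
Finite generation of L makes the bound uniform, so a high power of any prime works. Two coprime
multipliers suffice to separate, since a value is determined by its two coprime powers. -/

namespace TorusInvariants

open MvPolynomial

/-! ### Characters with values in the multiplicative group -/

section Characters

variable {k : Type*} [Field k] [IsAlgClosed k] [CharZero k]

/-- Provides the image of a generator of a cyclic group of order `d`; `d = 0` stands for infinite
order, as in `addOrderOf`. -/
theorem exists_ne_one_pow_eq_one {d : ℕ} (hd : d ≠ 1) : ∃ c : kˣ, c ≠ 1 ∧ c ^ d = 1 := by
  obtain rfl | h0 := eq_or_ne d 0
  · exact ⟨Units.mk0 (2 : k) two_ne_zero, fun h => by simpa using congrArg Units.val h, pow_zero _⟩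
  · have : NeZero (d : k) := ⟨Nat.cast_ne_zero.2 h0⟩
    have : NeZero d := ⟨h0⟩
    obtain ⟨ζ, hζ⟩ := HasEnoughRootsOfUnity.exists_primitiveRoot k d
    have hu := hζ.isUnit h0
    refine ⟨hu.unit, fun h => hd ?_, Units.ext (by simpa using hζ.pow_eq_one)⟩
    have h1 : ζ = 1 := by simpa using congrArg Units.val h
    exact Nat.dvd_one.1 (hζ.dvd_of_pow_eq_one 1 (by simp [h1]))

/-- The multiplicative group of an algebraically closed field of characteristic zero separates
the points of every abelian group. -/
theorem exists_addMonoidHom_units_ne_zero {G : Type*} [AddCommGroup G] {a : G} (ha : a ≠ 0) :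
    ∃ χ : G →+ Additive kˣ, χ a ≠ 0 := by
  obtain ⟨c, hc, hcd⟩ := exists_ne_one_pow_eq_one (k := k) (d := addOrderOf a)
    (by simpa using ha)
  -- Roots exist in `kˣ`, so it is divisible, hence injective: a character of the subgroup generated
  -- by `a` extends to `G`.
  let _ : DivisibleBy (Additive kˣ) ℤ := divisibleByOfSMulRightSurj _ _ <| by
    intro z hz x
    have key : ∀ m : ℕ, m ≠ 0 → ∃ y : kˣ, y ^ m = x.toMul := fun m hm => by
      obtain ⟨y, hy⟩ := IsAlgClosed.exists_pow_nat_eq ((x.toMul : kˣ) : k) (Nat.pos_of_ne_zero hm)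
      have hy0 : y ≠ 0 := by
        rintro rfl
        rw [zero_pow hm] at hy
        exact x.toMul.ne_zero hy.symm
      exact ⟨Units.mk0 y hy0, Units.ext (by simpa using hy)⟩
    obtain ⟨y, hy⟩ := key z.natAbs (by simpa using hz)
    obtain h | h := Int.natAbs_eq z
    · refine ⟨Additive.ofMul y, ?_⟩
      change z • Additive.ofMul y = x
      rw [h, natCast_zsmul, ← ofMul_pow, hy, ofMul_toMul]
    · refine ⟨Additive.ofMul y⁻¹, ?_⟩
      change z • Additive.ofMul y⁻¹ = x
      rw [h, neg_zsmul, natCast_zsmul, ← ofMul_pow, inv_pow, hy, ofMul_inv, neg_neg, ofMul_toMul]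
  let g : (ℤ ⧸ Ideal.span {(addOrderOf a : ℤ)}) →ₗ[ℤ] Additive kˣ :=
    Submodule.liftQSpanSingleton _ (LinearMap.toSpanSingleton ℤ _ (Additive.ofMul c)) (by
      rw [LinearMap.toSpanSingleton_apply, natCast_zsmul, ← ofMul_pow, hcd, ofMul_one])
  let f := g ∘ₗ (CharacterModule.intSpanEquivQuotAddOrderOf a).toLinearMap
  obtain ⟨χ, hχ⟩ := (Module.Baer.of_divisible (Additive kˣ)).extension_property_addMonoidHom
    (Submodule.subtype (Submodule.span ℤ {a})).toAddMonoidHom Subtype.val_injective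
    f.toAddMonoidHom
  refine ⟨χ, fun h => hc ?_⟩
  have h1 := DFunLike.congr_fun hχ ⟨a, Submodule.mem_span_singleton_self a⟩
  have h2 : χ a = g (CharacterModule.intSpanEquivQuotAddOrderOf a
      ⟨a, Submodule.mem_span_singleton_self a⟩) := h1
  rw [h, CharacterModule.intSpanEquivQuotAddOrderOf_apply_self] at h2
  have h3 : (0 : Additive kˣ) = (1 : ℤ) • Additive.ofMul c := h2
  rw [one_zsmul] at h3
  exact Additive.ofMul.injective h3.symm

/-- A subgroup of `ℤ^n` is cut out by the points of the torus `(kˣ)^n` it vanishes on. -/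
theorem exists_units_prod_zpow_ne_one {n : ℕ} (H : AddSubgroup (Fin n → ℤ)) {a : Fin n → ℤ}
    (ha : a ∉ H) :
    ∃ w : Fin n → kˣ, (∀ b ∈ H, ∏ i, w i ^ b i = 1) ∧ ∏ i, w i ^ a i ≠ 1 := by
  obtain ⟨χ, hχ⟩ := exists_addMonoidHom_units_ne_zero (k := k)
    (a := (QuotientAddGroup.mk a : (Fin n → ℤ) ⧸ H))
    (fun h => ha ((QuotientAddGroup.eq_zero_iff a).1 h))
  let ψ : (Fin n → ℤ) →+ Additive kˣ := χ.comp (QuotientAddGroup.mk' H)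
  have hψ : ∀ b, (∏ i, (ψ (Pi.single i 1)).toMul ^ b i) = (ψ b).toMul := fun b => by
    have hb : b = ∑ i, b i • (Pi.single i 1 : Fin n → ℤ) := by
      conv_lhs => rw [← Finset.univ_sum_single b]
      exact Finset.sum_congr rfl fun i _ => by
        rw [← Pi.single_smul, smul_eq_mul, mul_one]
    conv_rhs => rw [hb]
    rw [map_sum, toMul_sum]
    exact Finset.prod_congr rfl fun i _ => by rw [map_zsmul, toMul_zsmul]
  refine ⟨fun i => (ψ (Pi.single i 1)).toMul, fun b hb => ?_, fun h => hχ ?_⟩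
  · have h0 : ψ b = 0 := by
      change χ (QuotientAddGroup.mk b) = 0
      rw [(QuotientAddGroup.eq_zero_iff b).2 hb, map_zero]
    rw [hψ, h0, toMul_zero]
  · rw [hψ] at h
    exact Additive.toMul.injective h

end Characters

/-! ### Monomials and torus invariants -/

section Monomials

variable {k : Type*} [Field k] {r n : ℕ}

theorem eval_monomial_one (u : Fin n → k) (α : Fin n →₀ ℕ) :
    eval u (monomial α (1 : k)) = ∏ i, u i ^ α i := by
  rw [eval_monomial, one_mul, Finsupp.prod_fintype _ _ fun _ => pow_zero _]

theorem torusRep_apply (A : Matrix (Fin r) (Fin n) ℤ) (t : Fin r → kˣ) (u : Fin n → k)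
    (i : Fin n) :
    torusRep k A t u i = ((∏ j, t j ^ (-A j i) : kˣ) : k) * u i := rfl

theorem prod_torusRep_apply_pow (A : Matrix (Fin r) (Fin n) ℤ) (t : Fin r → kˣ) (u : Fin n → k)
    (α : Fin n →₀ ℕ) :
    ∏ i, (torusRep k A t u i) ^ α i =
      ((∏ j, t j ^ (-(A.mulVec (toIntVec α) j)) : kˣ) : k) * ∏ i, u i ^ α i := by
  simp_rw [torusRep_apply, mul_pow]
  rw [Finset.prod_mul_distrib]
  congr 1
  simp_rw [← Units.val_pow_eq_pow_val]
  rw [← Units.coe_prod]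
  congr 1
  simp_rw [← Finset.prod_pow]
  rw [Finset.prod_comm]
  refine Finset.prod_congr rfl fun j _ => ?_
  have : ∀ i, (t j ^ (-A j i)) ^ α i = t j ^ (-(A j i) * (α i : ℤ)) := fun i => by
    rw [zpow_mul, zpow_natCast]
  simp_rw [this]
  rw [Matrix.mulVec, dotProduct, ← Finset.sum_neg_distrib]
  simp_rw [← neg_mul]
  exact (map_prod (zpowersHom kˣ (t j))
    (fun i => Multiplicative.ofAdd (-A j i * toIntVec α i)) Finset.univ).symm

theorem monomialAlgebra_le_invariantRing (A : Matrix (Fin r) (Fin n) ℤ)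
    {S : AddSubmonoid (Fin n →₀ ℕ)} (hS : S ≤ invariantSemigroup A) :
    monomialAlgebra k S ≤ invariantRing (torusRep k A) := by
  refine Algebra.adjoin_le ?_
  rintro _ ⟨α, hα, rfl⟩ t u
  have h : A.mulVec (toIntVec α) = 0 := hS hα
  rw [eval_monomial_one, eval_monomial_one, prod_torusRep_apply_pow, h]
  simp

theorem eval_eq_of_mem_monomialAlgebra {S : AddSubmonoid (Fin n →₀ ℕ)} {u v : Fin n → k}
    (h : ∀ γ ∈ S, ∏ i, u i ^ γ i = ∏ i, v i ^ γ i) {f : MvPolynomial (Fin n) k}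
    (hf : f ∈ monomialAlgebra k S) : eval u f = eval v f := by
  induction hf using Algebra.adjoin_induction with
  | mem x hx =>
    obtain ⟨γ, hγ, rfl⟩ := hx
    simpa only [eval_monomial_one] using h γ hγ
  | algebraMap c => simp [algebraMap_eq]
  | add x y _ _ hx hy => rw [map_add, map_add, hx, hy]
  | mul x y _ _ hx hy => rw [map_mul, map_mul, hx, hy]

/-- A torus-invariant polynomial involves invariant monomials only. -/
theorem mem_invariantSemigroup_of_coeff_ne_zero [CharZero k] {A : Matrix (Fin r) (Fin n) ℤ}
    {f : MvPolynomial (Fin n) k} (hf : f ∈ invariantRing (torusRep k A)) {α : Fin n →₀ ℕ}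
    (hα : f.coeff α ≠ 0) : α ∈ invariantSemigroup A := by
  have key : ∀ t : Fin r → kˣ, ∏ j, t j ^ (-(A.mulVec (toIntVec α) j)) = 1 := by
    intro t
    -- `g` is `f` translated by `t`, written coefficientwise; it agrees with `f` at every point of
    -- an infinite field.
    let g : MvPolynomial (Fin n) k := ∑ β ∈ f.support, monomial β
      (((∏ j, t j ^ (-(A.mulVec (toIntVec β) j)) : kˣ) : k) * f.coeff β)
    have hg : g = f := by
      refine MvPolynomial.funext fun u => ?_
      rw [← hf t u, eval_eq' _ f, map_sum]
      refine Finset.sum_congr rfl fun β _ => ?_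
      rw [prod_torusRep_apply_pow, eval_monomial, Finsupp.prod_fintype _ _ fun _ => pow_zero _]
      ring
    have hc := congrArg (coeff α) hg
    rw [coeff_sum] at hc
    simp_rw [coeff_monomial] at hc
    rw [Finset.sum_ite_eq', if_pos (mem_support_iff.2 hα)] at hc
    exact Units.ext (mul_right_cancel₀ hα (by rw [hc, Units.val_one, one_mul]))
  refine funext fun j => ?_
  -- In characteristic zero 2 is not a root of unity, so this point forces the `j`-th weight to
  -- vanish.
  have h := key (Pi.mulSingle j (Units.mk0 (2 : k) two_ne_zero))
  rw [Finset.prod_eq_single j (fun i _ hi => by rw [Pi.mulSingle_eq_of_ne hi, one_zpow])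
    (fun h => absurd (Finset.mem_univ j) h), Pi.mulSingle_eq_same] at h
  have h2 : ((2 : ℚ) : ℚ) ^ (-(A.mulVec (toIntVec α) j)) = 1 := by
    have h3 : (2 : k) ^ (-(A.mulVec (toIntVec α) j)) = 1 := by
      simpa using congrArg Units.val h
    exact_mod_cast (algebraMap ℚ k).injective (by simpa using h3)
  have h3 := (zpow_eq_one_iff_right₀ (by norm_num) (by norm_num)).1 h2
  simpa using h3

end Monomials

/-! ### Separation of points by monomial algebras -/

section Separating

variable {k : Type*} [Field k] {r n : ℕ} {A : Matrix (Fin r) (Fin n) ℤ}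
  {S : AddSubmonoid (Fin n →₀ ℕ)}

theorem eq_of_pow_eq_of_coprime {a b : k} {P Q : ℕ} (hPQ : P.Coprime Q) (hP : P ≠ 0)
    (h₁ : a ^ P = b ^ P) (h₂ : a ^ Q = b ^ Q) : a = b := by
  obtain rfl | hb := eq_or_ne b 0
  · rw [zero_pow hP] at h₁
    exact eq_zero_of_pow_eq_zero h₁
  · have h₁' : (a / b) ^ P = 1 := by rw [div_pow, h₁, div_self (pow_ne_zero _ hb)]
    have h₂' : (a / b) ^ Q = 1 := by rw [div_pow, h₂, div_self (pow_ne_zero _ hb)]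
    have h := orderOf_dvd_of_pow_eq_one h₁'
    have h' := Nat.dvd_gcd h (orderOf_dvd_of_pow_eq_one h₂')
    rw [hPQ, Nat.dvd_one, orderOf_eq_one_iff] at h'
    exact (div_eq_one_iff_eq hb).1 h'

theorem prod_pow_smul (u : Fin n → k) (N : ℕ) (α : Fin n →₀ ℕ) :
    ∏ i, u i ^ (N • α) i = (∏ i, u i ^ α i) ^ N := by
  simp_rw [Finsupp.smul_apply, smul_eq_mul, mul_comm N, pow_mul, Finset.prod_pow]

theorem isSeparatingAlgebra_of_coprime_smul_mem [CharZero k] (hS : S ≤ invariantSemigroup A)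
    {P Q : ℕ} (hPQ : P.Coprime Q) (hP0 : P ≠ 0) (hP : ∀ α ∈ invariantSemigroup A, P • α ∈ S)
    (hQ : ∀ α ∈ invariantSemigroup A, Q • α ∈ S) :
    IsSeparatingAlgebra (torusRep k A) (monomialAlgebra k S) := by
  refine ⟨monomialAlgebra_le_invariantRing A hS, fun u v ⟨f, hf, hne⟩ => ?_⟩
  by_contra! hB
  have hB' : ∀ γ ∈ S, ∏ i, u i ^ γ i = ∏ i, v i ^ γ i := fun γ hγ => by
    simpa only [eval_monomial_one] using
      hB _ (Algebra.subset_adjoin (Set.mem_image_of_mem _ hγ))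
  refine hne ?_
  rw [eval_eq', eval_eq']
  refine Finset.sum_congr rfl fun α hα => ?_
  have hαL := mem_invariantSemigroup_of_coeff_ne_zero hf (mem_support_iff.1 hα)
  congr 1
  refine eq_of_pow_eq_of_coprime hPQ hP0 ?_ ?_
  · simpa only [prod_pow_smul] using hB' _ (hP α hαL)
  · simpa only [prod_pow_smul] using hB' _ (hQ α hαL)

/-- If a separating monomial algebra does not separate `u` and `v`, no invariant monomial does. -/
theorem IsSeparatingAlgebra.prod_pow_eq
    (h : IsSeparatingAlgebra (torusRep k A) (monomialAlgebra k S)) {u v : Fin n → k}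
    (huv : ∀ γ ∈ S, ∏ i, u i ^ γ i = ∏ i, v i ^ γ i) {α : Fin n →₀ ℕ}
    (hα : α ∈ invariantSemigroup A) : ∏ i, u i ^ α i = ∏ i, v i ^ α i := by
  by_contra hne
  obtain ⟨f, hf, hfne⟩ := h.2 u v ⟨monomial α 1,
    monomialAlgebra_le_invariantRing A le_rfl
      (Algebra.subset_adjoin (Set.mem_image_of_mem _ hα)),
    by simpa only [eval_monomial_one] using hne⟩
  exact hfne (eval_eq_of_mem_monomialAlgebra huv hf)

theorem prod_ite_pow (I : Finset (Fin n)) (w : Fin n → k) (γ : Fin n →₀ ℕ) :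
    ∏ i, (if i ∈ I then w i else 0) ^ γ i =
      if γ.support ⊆ I then ∏ i, w i ^ γ i else 0 := by
  split_ifs with h
  · refine Finset.prod_congr rfl fun i _ => ?_
    split_ifs with hi
    · rfl
    · rw [Finsupp.notMem_support_iff.1 fun h' => hi (h h'), pow_zero, pow_zero]
  · obtain ⟨i, hi, hiI⟩ := Finset.not_subset.1 h
    exact Finset.prod_eq_zero (Finset.mem_univ i)
      (by rw [if_neg hiI, zero_pow (Finsupp.mem_support_iff.1 hi)])

/-- Otherwise the indicator vectors of `supp α` and of `supp α` without `i` agree on S, while `x^α`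
tells them apart. -/
theorem IsSeparatingAlgebra.exists_support_subset
    (h : IsSeparatingAlgebra (torusRep k A) (monomialAlgebra k S)) {α : Fin n →₀ ℕ}
    (hα : α ∈ invariantSemigroup A) {i : Fin n} (hi : α i ≠ 0) :
    ∃ γ ∈ S, i ∈ γ.support ∧ γ.support ⊆ α.support := by
  by_contra! hno
  have huv : ∀ γ ∈ S, ∏ j, (if j ∈ α.support then (1 : k) else 0) ^ γ j =
      ∏ j, (if j ∈ α.support.erase i then (1 : k) else 0) ^ γ j := fun γ hγ => by
    have hiff : γ.support ⊆ α.support ↔ γ.support ⊆ α.support.erase i :=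
      ⟨fun hsub => Finset.subset_erase.2 ⟨hsub, fun h' => hno γ hγ h' hsub⟩,
        fun hsub => hsub.trans (Finset.erase_subset _ _)⟩
    rw [prod_ite_pow _ fun _ => 1, prod_ite_pow _ fun _ => 1]
    simp only [hiff]
  have hcontra := h.prod_pow_eq huv hα
  rw [prod_ite_pow _ fun _ => 1, prod_ite_pow _ fun _ => 1, if_pos subset_rfl, if_neg] at hcontra
  · simp at hcontra
  · exact fun hsub => Finset.notMem_erase i _ (hsub (Finsupp.mem_support_iff.2 hi))

theorem IsSeparatingAlgebra.toIntVec_mem_integerSpan [IsAlgClosed k] [CharZero k]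
    (h : IsSeparatingAlgebra (torusRep k A) (monomialAlgebra k S)) {I : Finset (Fin n)}
    {α : Fin n →₀ ℕ} (hα : α ∈ supportedIn (invariantSemigroup A) I)
    (hS : S ≤ invariantSemigroup A) :
    toIntVec α ∈ integerSpan (supportedIn (invariantSemigroup A) I ⊓ S) := by
  by_contra hno
  obtain ⟨w, hw, hwα⟩ := exists_units_prod_zpow_ne_one (k := k) _ hno
  have hcoe : ∀ γ : Fin n →₀ ℕ, ∏ i, (w i : k) ^ γ i = ((∏ i, w i ^ toIntVec γ i : kˣ) : k) :=
    fun γ => by simp [toIntVec]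
  have huv : ∀ γ ∈ S, ∏ j, (if j ∈ I then (1 : k) else 0) ^ γ j =
      ∏ j, (if j ∈ I then (w j : k) else 0) ^ γ j := fun γ hγ => by
    rw [prod_ite_pow _ fun _ => 1, prod_ite_pow _ fun j => (w j : k)]
    split_ifs with hsub
    · rw [hcoe, hw _ (AddSubgroup.subset_closure (Set.mem_image_of_mem _
        ⟨⟨hS hγ, fun j hj => Finsupp.notMem_support_iff.1 fun h' => hj (hsub h')⟩, hγ⟩))]
      simp
    · rfl
  have hsub : α.support ⊆ I := fun j hj => by
    by_contra hjI
    exact Finsupp.mem_support_iff.1 hj (hα.2 j hjI)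
  have hcontra := h.prod_pow_eq huv hα.1
  rw [prod_ite_pow _ fun _ => 1, prod_ite_pow _ fun j => (w j : k), if_pos hsub, if_pos hsub,
    hcoe] at hcontra
  refine hwα (Units.ext ?_)
  rw [← hcontra]
  simp

end Separating

/-! ### Multiples of elements of L lying in S -/

section Semigroups

variable {r n : ℕ} {A : Matrix (Fin r) (Fin n) ℤ} {S : AddSubmonoid (Fin n →₀ ℕ)}

theorem toIntVec_add (α β : Fin n →₀ ℕ) : toIntVec (α + β) = toIntVec α + toIntVec β := by
  funext i
  simp [toIntVec]

theorem toIntVec_injective : Function.Injective (toIntVec (n := n)) := fun α β h =>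
  Finsupp.ext fun i => by simpa [toIntVec] using congrFun h i

theorem mem_invariantSemigroup_of_add_mem {α β : Fin n →₀ ℕ} (hα : α ∈ invariantSemigroup A)
    (h : α + β ∈ invariantSemigroup A) : β ∈ invariantSemigroup A := by
  change A.mulVec (toIntVec (α + β)) = 0 at h
  change A.mulVec (toIntVec α) = 0 at hα
  rwa [toIntVec_add, Matrix.mulVec_add, hα, zero_add] at h

theorem invariantSemigroup_fg (A : Matrix (Fin r) (Fin n) ℤ) : (invariantSemigroup A).FG :=
  AddSubmonoid.fg_of_subtractive fun _ hα _ h => mem_invariantSemigroup_of_add_mem hα h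

/-- If every coordinate of an element of `L` is witnessed by an element of `S` of no larger
support, then `S` and `L` span the same rational cone. -/
theorem exists_pos_smul_mem (hS : S ≤ invariantSemigroup A)
    (hsupp : ∀ α ∈ invariantSemigroup A, ∀ i : Fin n, α i ≠ 0 →
      ∃ γ ∈ S, i ∈ γ.support ∧ γ.support ⊆ α.support)
    (β : Fin n →₀ ℕ) (hβ : β ∈ invariantSemigroup A) : ∃ e : ℕ, 0 < e ∧ e • β ∈ S := by
  induction hc : β.support.card using Nat.strong_induction_on generalizing β with
  | _ c ih =>
    obtain rfl | h0 := eq_or_ne β 0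
    · exact ⟨1, one_pos, by simp⟩
    obtain ⟨i, hi⟩ := Finsupp.ne_iff.1 h0
    obtain ⟨γ, hγS, hiγ, hγβ⟩ := hsupp β hβ i hi
    -- The minimal ratio makes `γ j • β - β j • γ` nonnegative and zero at `j`, so its support is
    -- strictly smaller.
    obtain ⟨j, hj, hmin⟩ := γ.support.exists_min_image
      (fun l => (β l : ℚ) / (γ l : ℚ)) ⟨i, hiγ⟩
    have hγj : 0 < γ j := Nat.pos_of_ne_zero (Finsupp.mem_support_iff.1 hj)
    have hle : β j • γ ≤ γ j • β := fun l => by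
      simp only [Finsupp.smul_apply, smul_eq_mul]
      by_cases hl : l ∈ γ.support
      · have hγl : 0 < γ l := Nat.pos_of_ne_zero (Finsupp.mem_support_iff.1 hl)
        have h := hmin l hl
        rw [div_le_div_iff₀ (by exact_mod_cast hγj) (by exact_mod_cast hγl)] at h
        rw [mul_comm (γ j)]
        exact_mod_cast h
      · rw [Finsupp.notMem_support_iff.1 hl, mul_zero]
        exact Nat.zero_le _
    obtain ⟨δ, hδ⟩ := exists_add_of_le hle
    have hδL : δ ∈ invariantSemigroup A := mem_invariantSemigroup_of_add_mem
      (AddSubmonoid.nsmul_mem _ (hS hγS) _) (hδ ▸ AddSubmonoid.nsmul_mem _ hβ _)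
    have happ : ∀ l, γ j * β l = β j * γ l + δ l := fun l => by
      simpa using DFunLike.congr_fun hδ l
    have hlt : δ.support ⊂ β.support := by
      refine (Finset.ssubset_iff_of_subset fun l hl => ?_).2 ⟨j, hγβ hj, ?_⟩
      · rw [Finsupp.mem_support_iff] at hl ⊢
        intro hl0
        have := happ l
        rw [hl0, mul_zero] at this
        omega
      · rw [Finsupp.notMem_support_iff]
        have := happ j
        rw [mul_comm] at this
        omega
    obtain ⟨e, he, heS⟩ := ih _ (hc ▸ Finset.card_lt_card hlt) δ hδL rfl
    refine ⟨e * γ j, Nat.mul_pos he hγj, ?_⟩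
    rw [mul_smul, hδ, smul_add]
    exact S.add_mem (AddSubmonoid.nsmul_mem _ (AddSubmonoid.nsmul_mem _ hγS _) _) heS

theorem exists_add_eq_of_mem_integerSpan {M : AddSubmonoid (Fin n →₀ ℕ)} {x : Fin n → ℤ}
    (hx : x ∈ integerSpan M) : ∃ s ∈ M, ∃ t ∈ M, x + toIntVec t = toIntVec s := by
  induction hx using AddSubgroup.closure_induction with
  | mem x hx =>
    obtain ⟨s, hs, rfl⟩ := hx
    exact ⟨s, hs, 0, M.zero_mem, by rw [← toIntVec_add, add_zero]⟩
  | zero => exact ⟨0, M.zero_mem, 0, M.zero_mem, zero_add _⟩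
  | add x y _ _ hx hy =>
    obtain ⟨s, hs, t, ht, h⟩ := hx
    obtain ⟨s', hs', t', ht', h'⟩ := hy
    refine ⟨s + s', M.add_mem hs hs', t + t', M.add_mem ht ht', ?_⟩
    rw [toIntVec_add, toIntVec_add, ← h, ← h']
    abel
  | neg x _ hx =>
    obtain ⟨s, hs, t, ht, h⟩ := hx
    exact ⟨t, ht, s, hs, by rw [← h]; abel⟩

theorem exists_forall_ge_smul_mem_of_consecutive {M : Type*} [AddCommMonoid M]
    {S : AddSubmonoid M} {a : M} {c : ℕ} (h₁ : c • a ∈ S) (h₂ : (c + 1) • a ∈ S) :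
    ∃ N₀ : ℕ, ∀ N ≥ N₀, N • a ∈ S := by
  obtain rfl | hc := Nat.eq_zero_or_pos c
  · refine ⟨0, fun N _ => ?_⟩
    simpa using AddSubmonoid.nsmul_mem _ h₂ N
  -- With `N = qc + r` and `r < c ≤ q`, one has `N = (q - r)c + r(c + 1)`.
  refine ⟨c * c, fun N hN => ?_⟩
  have hlt := Nat.mod_lt N hc
  have hdiv : c ≤ N / c := (Nat.le_div_iff_mul_le hc).2 hN
  have hN' : N = (N / c - N % c) * c + (N % c) * (c + 1) := by
    obtain ⟨d, hd⟩ := Nat.exists_eq_add_of_le (hlt.le.trans hdiv)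
    have h := Nat.div_add_mod N c
    rw [hd] at h ⊢
    rw [Nat.add_sub_cancel_left]
    conv_lhs => rw [← h]
    ring
  rw [hN', add_smul, mul_smul, mul_smul]
  exact S.add_mem (AddSubmonoid.nsmul_mem _ h₁ _) (AddSubmonoid.nsmul_mem _ h₂ _)

/-- Write `α + t = s` with `s, t` in S. Some `Kα - t` lies in L and has a multiple by `e > 0` in S;
then `eKα` is in S, and trading one `t` for `s` gives `(eK + 1)α`. -/
theorem exists_forall_ge_smul_mem (hS : S ≤ invariantSemigroup A)
    (hspan : ∀ I : Finset (Fin n), ∀ α ∈ supportedIn (invariantSemigroup A) I,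
      toIntVec α ∈ integerSpan (supportedIn (invariantSemigroup A) I ⊓ S))
    (hsupp : ∀ α ∈ invariantSemigroup A, ∀ i : Fin n, α i ≠ 0 →
      ∃ γ ∈ S, i ∈ γ.support ∧ γ.support ⊆ α.support)
    {α : Fin n →₀ ℕ} (hα : α ∈ invariantSemigroup A) :
    ∃ N₀ : ℕ, ∀ N ≥ N₀, N • α ∈ S := by
  obtain ⟨s, ⟨-, hs⟩, t, ⟨⟨-, htI⟩, ht⟩, hst⟩ := exists_add_eq_of_mem_integerSpan
    (hspan α.support α ⟨hα, fun j hj => Finsupp.notMem_support_iff.1 hj⟩)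
  have hst' : α + t = s := toIntVec_injective (by rw [toIntVec_add, hst])
  -- `K` bounds every coordinate of `t`, and `α` is at least 1 on its support, which contains that
  -- of `t`.
  let K := ∑ i, t i
  have hle : t ≤ K • α := fun i => by
    by_cases hi : i ∈ α.support
    · exact (Finset.single_le_sum (f := fun i => t i) (fun _ _ => Nat.zero_le _)
        (Finset.mem_univ i)).trans
        (Nat.le_mul_of_pos_right _ (Nat.pos_of_ne_zero (Finsupp.mem_support_iff.1 hi)))
    · rw [htI i hi]
      exact Nat.zero_le _
  obtain ⟨δ, hδ⟩ := exists_add_of_le hle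
  have hδL : δ ∈ invariantSemigroup A := mem_invariantSemigroup_of_add_mem
    (hS ht) (hδ ▸ AddSubmonoid.nsmul_mem _ hα _)
  obtain ⟨e, he, heS⟩ := exists_pos_smul_mem hS hsupp δ hδL
  have h₁ : (e * K) • α = e • t + e • δ := by rw [mul_smul, hδ, smul_add]
  refine exists_forall_ge_smul_mem_of_consecutive (c := e * K) ?_ ?_
  · rw [h₁]
    exact S.add_mem (AddSubmonoid.nsmul_mem _ ht _) heS
  · obtain ⟨d, rfl⟩ := Nat.exists_eq_add_of_lt he
    have h₂ : ((0 + d + 1) * K + 1) • α = s + (d • t + (0 + d + 1) • δ) := by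
      rw [add_smul, h₁, one_smul, ← hst', zero_add, add_smul d 1 t, one_smul]
      abel
    rw [h₂]
    exact S.add_mem hs (S.add_mem (AddSubmonoid.nsmul_mem _ ht _) heS)

theorem exists_forall_ge_forall_smul_mem {M : Type*} [AddCommMonoid M] {L S : AddSubmonoid M}
    (hL : L.FG) (h : ∀ a ∈ L, ∃ N₀ : ℕ, ∀ N ≥ N₀, N • a ∈ S) :
    ∃ N₀ : ℕ, ∀ N ≥ N₀, ∀ a ∈ L, N • a ∈ S := by
  obtain ⟨G, rfl⟩ := hL
  choose! N₀ hN₀ using fun a (ha : a ∈ G) => h a (AddSubmonoid.subset_closure ha)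
  refine ⟨G.sup N₀, fun N hN a ha => ?_⟩
  induction ha using AddSubmonoid.closure_induction with
  | mem a ha => exact hN₀ a ha N ((Finset.le_sup ha).trans hN)
  | zero => simp
  | add a b _ _ ha hb => simpa only [smul_add] using S.add_mem ha hb

end Semigroups

end TorusInvariants

theorem proposition5p3 {k : Type*} [Field k] [IsAlgClosed k] [CharZero k] {r n : ℕ}
    (A : Matrix (Fin r) (Fin n) ℤ) (S : AddSubmonoid (Fin n →₀ ℕ))
    (hS : S ≤ TorusInvariants.invariantSemigroup A) :
    List.TFAE
      [ TorusInvariants.IsSeparatingAlgebra (TorusInvariants.torusRep k A)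
          (TorusInvariants.monomialAlgebra k S),
        (∀ I : Finset (Fin n),
          ∀ α ∈ TorusInvariants.supportedIn (TorusInvariants.invariantSemigroup A) I,
            TorusInvariants.toIntVec α ∈ TorusInvariants.integerSpan
              (TorusInvariants.supportedIn (TorusInvariants.invariantSemigroup A) I ⊓ S)) ∧
        (∀ α ∈ TorusInvariants.invariantSemigroup A, ∀ i : Fin n, α i ≠ 0 →
          ∃ γ ∈ S, i ∈ γ.support ∧ γ.support ⊆ α.support),
        ∀ p : ℕ, p.Prime → ∃ m : ℕ, 1 ≤ m ∧
          ∀ α ∈ TorusInvariants.invariantSemigroup A, p ^ m • α ∈ S,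
        ∃ p q : ℕ, p.Prime ∧ q.Prime ∧ p ≠ q ∧ ∃ m : ℕ, 1 ≤ m ∧
          (∀ α ∈ TorusInvariants.invariantSemigroup A, p ^ m • α ∈ S) ∧
          (∀ α ∈ TorusInvariants.invariantSemigroup A, q ^ m • α ∈ S) ] := by
  tfae_have 1 → 2 := fun h =>
    ⟨fun _ _ hα => h.toIntVec_mem_integerSpan hα hS, fun _ hα _ hi => h.exists_support_subset hα hi⟩
  tfae_have 2 → 3 := by
    rintro ⟨hspan, hsupp⟩ p hp
    obtain ⟨N₀, hN₀⟩ := TorusInvariants.exists_forall_ge_forall_smul_mem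
      (TorusInvariants.invariantSemigroup_fg A)
      fun α hα => TorusInvariants.exists_forall_ge_smul_mem hS hspan hsupp hα
    -- The successor ensures `m ≥ 1`, and `p ^ m > m` exceeds the bound.
    exact ⟨N₀ + 1, Nat.le_add_left _ _,
      hN₀ _ ((Nat.le_succ _).trans (Nat.lt_pow_self hp.one_lt).le)⟩
  tfae_have 3 → 4 := by
    intro h
    obtain ⟨a, ha, h2⟩ := h 2 Nat.prime_two
    obtain ⟨b, hb, h3⟩ := h 3 Nat.prime_three
    refine ⟨2, 3, Nat.prime_two, Nat.prime_three, by norm_num, a + b, by omega,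
      fun α hα => ?_, fun α hα => ?_⟩
    · rw [pow_add, mul_smul]
      exact h2 _ (AddSubmonoid.nsmul_mem _ hα _)
    · rw [add_comm, pow_add, mul_smul]
      exact h3 _ (AddSubmonoid.nsmul_mem _ hα _)
  tfae_have 4 → 1 := by
    rintro ⟨p, q, hp, hq, hpq, m, -, hpm, hqm⟩
    exact TorusInvariants.isSeparatingAlgebra_of_coprime_smul_mem hS
      (((Nat.coprime_primes hp hq).2 hpq).pow m m) (pow_ne_zero _ hp.ne_zero) hpm hqm
  tfae_finish
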